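/- Let $k$ be an infinite field, and let $\Theta$ be the variety of all linear algebras over $k$, that is, $k$-vector spaces with a bilinear multiplication, not necessarily associative, commutative or unital. Let $\Theta^0$ be the category whose objects are the free linear algebras $F(X)$ on the finite subsets $X$ of a fixed countably infinite set of symbols, and whose morphisms are all homomorphisms of linear algebras between them. Let $\mathfrak{A}$ be the group, under composition, of all automorphisms of the category $\Theta^0$ (functors $\Theta^0\to\Theta^0$ with a strict two-sided inverse), and let $\mathfrak{Y}\trianglelefteq\mathfrak{A}$ be the normal subgroup of inner automorphisms, that is, those isomorphic as functors to the identity functor. Then the following hold. 1. $\mathfrak{A}/\mathfrak{Y}\cong (G/k^*I_2)\rtimes\operatorname{Aut}k$. Here $G$ is the group of all invertible $2\times 2$ matrices over $k$ of the form $\begin{pmatrix}a&b\\ b&a\end{pmatrix}$, $k^*I_2\le G$ is the subgroup of invertible scalar matrices, and $\operatorname{Aut}k$ is the group of field automorphisms of $k$, which acts on $G/k^*I_2$ through its entrywise action on $G$. 2. $\mathfrak{A}/\mathfrak{Y}\cong \bigl(U(k\mathbf{S}_2)/U(k\{e\})\bigr)\rtimes\operatorname{Aut}k$. Here $\mathbf{S}_2$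 is the symmetric group on two elements with identity $e$, $k\mathbf{S}_2$ is its group algebra, $k\{e\}\subseteq k\mathbf{S}_2$ is the subalgebra of scalar multiples of $e$, $U(\cdot)$ denotes the group of invertible elements, and $\varphi\in\operatorname{Aut}k$ acts by $\varphi(ae+b(12))=\varphi(a)e+\varphi(b)(12)$. 3. $\mathfrak{A}/\mathfrak{Y}$ is infinite, for every infinite field $k$ (in particular even when $\operatorname{Aut}k$ is trivial). -/

import Mathlib

open CategoryTheory

noncomputable section

namespace LinearAlgebras

universe u

/-- An object of the category `Θ⁰`: a finite subset `X` of a fixed countable set of symbols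
(indexed by `ℕ`), standing for the free linear (not necessarily associative, commutative or unital)
`k`-algebra `F(X)`. -/
structure FreeAlg (k : Type u) where
  gens : Finset ℕ

namespace FreeAlg

/-- The free linear algebra `F(X)` over `k`. -/
abbrev carrier {k : Type u} [Field k] (X : FreeAlg k) : Type u :=
  FreeNonUnitalNonAssocAlgebra k X.gens

/-- The category `Θ⁰`: morphisms are all homomorphisms of linear `k`-algebras. -/
instance (k : Type u) [Field k] : Category.{u} (FreeAlg k) where
  Hom X Y := X.carrier →ₙₐ[k] Y.carrier
  id X := NonUnitalAlgHom.id k X.carrier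
  comp f g := NonUnitalAlgHom.comp g f

end FreeAlg

/-- The group of all automorphisms of a category `C`: functors `C ⥤ C` with a strict two-sided
inverse, multiplied by composition. -/
abbrev CatAut (C : Type*) [Category C] := Aut (Cat.of C)

/-- The subgroup of inner automorphisms: those isomorphic, as functors, to the identity. -/
def innerAut (C : Type*) [Category C] : Subgroup (CatAut C) where
  carrier := {Φ | Nonempty (Φ.hom.toFunctor ≅ 𝟭 C)}
  one_mem' := ⟨Iso.refl _⟩
  mul_mem' := by
    rintro Φ Ψ ⟨e⟩ ⟨f⟩
    exact ⟨Functor.isoWhiskerRight f Φ.hom.toFunctor ≪≫ Functor.leftUnitor _ ≪≫ e⟩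
  inv_mem' := by
    rintro Φ ⟨e⟩
    have h : Φ.inv.toFunctor ⋙ Φ.hom.toFunctor = 𝟭 C :=
      congrArg Cat.Hom.toFunctor Φ.inv_hom_id
    exact ⟨(Functor.rightUnitor _).symm ≪≫ Functor.isoWhiskerLeft Φ.inv.toFunctor e.symm ≪≫
      eqToIso h⟩

instance (C : Type*) [Category C] : (innerAut C).Normal where
  conj_mem := by
    rintro Φ ⟨e⟩ Ψ
    have h : Ψ.inv.toFunctor ⋙ Ψ.hom.toFunctor = 𝟭 C :=
      congrArg Cat.Hom.toFunctor Ψ.inv_hom_id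
    exact ⟨Functor.isoWhiskerLeft Ψ.inv.toFunctor
      (Functor.isoWhiskerRight e Ψ.hom.toFunctor ≪≫ Functor.leftUnitor _) ≪≫ eqToIso h⟩

section Actions

variable {A N : Type*} [Group A] [Group N] (act : A →* MulAut N) (H : Subgroup N)
  (hH : ∀ a, ∀ x ∈ H, act a x ∈ H)

/-- The restriction of an action by automorphisms to an invariant subgroup. -/
def restrictAction : A →* MulAut H where
  toFun a :=
    { toFun := fun x => ⟨act a x, hH a x x.2⟩
      invFun := fun x => ⟨act a⁻¹ x, hH a⁻¹ x x.2⟩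
      left_inv := fun x => by ext; simp
      right_inv := fun x => by ext; simp
      map_mul' := fun x y => by ext; simp }
  map_one' := by ext; simp
  map_mul' a b := by ext; simp

/-- The action by automorphisms induced on the quotient by an invariant normal subgroup. -/
def quotientAction [H.Normal] : A →* MulAut (N ⧸ H) where
  toFun a := QuotientGroup.congr H H (act a) (by
    ext x
    constructor
    · rintro ⟨y, hy, rfl⟩
      exact hH a y hy
    · intro hx
      exact ⟨act a⁻¹ x, hH a⁻¹ x hx, by simp⟩)
  map_one' := by
    ext x
    induction x using QuotientGroup.induction_on
    simp
  map_mul' a b := by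
    ext x
    induction x using QuotientGroup.induction_on
    simp

end Actions

variable (k : Type u) [Field k]

/-- The entrywise action of the field automorphisms `Aut k` on `GL₂(k)`. -/
def autActGL : RingAut k →* MulAut (GL (Fin 2) k) where
  toFun φ := Units.mapEquiv (φ.mapMatrix (m := Fin 2)).toMulEquiv
  map_one' := by ext; rfl
  map_mul' _ _ := by ext; rfl

/-- The group `G` of all regular matrices `(a b; b a)` over `k`. -/
def matG : Subgroup (GL (Fin 2) k) where
  carrier := {g | ∃ a b : k, (g : Matrix (Fin 2) (Fin 2) k) = !![a, b; b, a]}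
  one_mem' := ⟨1, 0, by simp [Matrix.one_fin_two]⟩
  mul_mem' := by
    rintro g h ⟨a, b, hg⟩ ⟨c, d, hh⟩
    refine ⟨a * c + b * d, a * d + b * c, ?_⟩
    rw [Units.val_mul, hg, hh, Matrix.mul_fin_two]
    congr 1
    simp [add_comm]
  inv_mem' := by
    rintro g ⟨a, b, hg⟩
    refine ⟨Ring.inverse (a * a - b * b) * a, -(Ring.inverse (a * a - b * b) * b), ?_⟩
    rw [Matrix.coe_units_inv, hg, Matrix.inv_def, Matrix.det_fin_two_of, Matrix.adjugate_fin_two_of]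
    simp

/-- The group `k* I₂` of regular scalar matrices, as a subgroup of `G`. -/
def scalarMat : Subgroup (matG k) :=
  (Matrix.GeneralLinearGroup.scalar (Fin 2) (R := k)).range.subgroupOf (matG k)

instance : (scalarMat k).Normal where
  conj_mem := by
    rintro g ⟨c, hc⟩ h
    have hcom : Commute (h : GL (Fin 2) k) (g : GL (Fin 2) k) := by
      have hc' : Matrix.GeneralLinearGroup.scalar (Fin 2) c = (g : GL (Fin 2) k) := hc
      rw [← hc']
      exact (Matrix.GeneralLinearGroup.scalar_commute c _).symm
    have : h * g * h⁻¹ = g := by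
      rw [show h * g = g * h from Subtype.ext hcom.eq]
      simp
    rw [this]
    exact ⟨c, hc⟩

/-- The action of `Aut k` on `G`, entry by entry. -/
def autActG : RingAut k →* MulAut (matG k) :=
  restrictAction (autActGL k) (matG k) (by
    rintro φ g ⟨a, b, hg⟩
    refine ⟨φ a, φ b, ?_⟩
    change (g : Matrix (Fin 2) (Fin 2) k).map φ = _
    rw [hg]
    ext i j
    fin_cases i <;> fin_cases j <;> rfl)

/-- The induced action of `Aut k` on `G / k* I₂`. -/
def autActMatQuotient : RingAut k →* MulAut (matG k ⧸ scalarMat k) :=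
  quotientAction (autActG k) (scalarMat k) (by
    rintro φ g ⟨c, hc⟩
    refine ⟨Units.map (φ : k →* k) c, ?_⟩
    have hc' : Matrix.GeneralLinearGroup.scalar (Fin 2) c = (g : GL (Fin 2) k) := hc
    change _ = autActGL k φ (g : GL (Fin 2) k)
    rw [← hc']
    exact (Matrix.GeneralLinearGroup.map_scalar (φ : k →+* k) c).symm)

/-- The group algebra `k S₂`. -/
abbrev kS₂ := MonoidAlgebra k (Equiv.Perm (Fin 2))

/-- The subalgebra `k{e}` of `k S₂`, consisting of the multiples of the identity permutation. -/
def kE : Subalgebra k (kS₂ k) := Algebra.adjoin k {MonoidAlgebra.single 1 1}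

/-- `U(k{e})`, as a subgroup of `U(k S₂)`. -/
def unitsKE : Subgroup (kS₂ k)ˣ := (Units.map ((kE k).val : kE k →* kS₂ k)).range

theorem kE_eq_bot : kE k = ⊥ := by
  rw [kE, ← MonoidAlgebra.one_def]
  exact Algebra.adjoin_singleton_one k _

theorem mem_unitsKE (u : (kS₂ k)ˣ) :
    u ∈ unitsKE k ↔ ∃ c : kˣ, (u : kS₂ k) = algebraMap k (kS₂ k) c := by
  constructor
  · rintro ⟨v, rfl⟩
    obtain ⟨c, hc⟩ : (v : kS₂ k) ∈ (⊥ : Subalgebra k (kS₂ k)) := kE_eq_bot k ▸ (v : kE k).2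
    have hc0 : c ≠ 0 := by
      rintro rfl
      have hv : (v : kE k) = 0 := Subtype.ext (hc.symm.trans (map_zero _))
      exact v.ne_zero hv
    exact ⟨Units.mk0 c hc0, hc.symm⟩
  · rintro ⟨c, hc⟩
    exact ⟨Units.map (algebraMap k (kE k) : k →* kE k) c, Units.ext hc.symm⟩

instance : (unitsKE k).Normal where
  conj_mem := by
    intro u hu v
    obtain ⟨c, hc⟩ := (mem_unitsKE k u).1 hu
    have : v * u = u * v := Units.ext (by
      rw [Units.val_mul, Units.val_mul, hc]
      exact (Algebra.commutes _ _).symm)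
    rwa [this, mul_inv_cancel_right]

/-- The action of `Aut k` on `U(k S₂)`, through the coefficients:
`φ(a e + b (12)) = φ(a) e + φ(b) (12)`. -/
def autActKS₂ : RingAut k →* MulAut (kS₂ k)ˣ where
  toFun φ := Units.mapEquiv (MonoidAlgebra.mapRingEquiv (Equiv.Perm (Fin 2)) φ).toMulEquiv
  map_one' := by
    ext u : 2
    refine MonoidAlgebra.ext (Finsupp.ext fun g => ?_)
    exact MonoidAlgebra.coeff_mapRingEquiv _ _ _
  map_mul' φ ψ := by
    ext u : 2
    refine MonoidAlgebra.ext (Finsupp.ext fun g => ?_)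
    simp

/-- The induced action of `Aut k` on `U(k S₂) / U(k{e})`. -/
def autActUnitsQuotient : RingAut k →* MulAut ((kS₂ k)ˣ ⧸ unitsKE k) :=
  quotientAction (autActKS₂ k) (unitsKE k) (by
    intro φ u hu
    obtain ⟨c, hc⟩ := (mem_unitsKE k u).1 hu
    refine (mem_unitsKE k _).2 ⟨Units.map (φ : k →* k) c, ?_⟩
    change MonoidAlgebra.mapRingEquiv (Equiv.Perm (Fin 2)) φ (u : kS₂ k) = _
    rw [hc]
    simp)

end LinearAlgebras

end

/-!
The idea is to recognise an automorphism of `Θ⁰` by the way in which it acts on elements. An element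
of `F(X)` is a morphism `F(x) → F(X)` from the free algebra in one variable. Up to isomorphism,
`F(x)` is the smallest nonzero object for the relation of being a retract, so an autoequivalence `Φ`
preserves it (`nonempty_iso_obj_one`) and therefore acts on elements by bijections
`F(X) → Φ F(X)`, which carry the generators to free generators. Identifying `Φ F(X)` with `F(X)` by
means of these generators, one finds that `Φ` is isomorphic to the functor `f ↦ σ_Y f σ_X⁻¹`, for a
family of permutations `σ_X` of `F(X)` that fix the generators and respect substitution
(`IsVerbal`).

Such a family is determined by the polynomials `σ (c x)`, `σ (x + y)` and `σ (x y)`. The first one is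
invertible under substitution, so by comparison of top degrees it is linear
(`eq_smul_of_of_lift_const_eq_of`), and `σ` is semilinear for a bijection `φ` of `k`. Because `σ`
commutes with rescaling, and because `k` is infinite, `σ (x + y)` is homogeneous of degree one and
`σ (x y)` is homogeneous of degree one in both variables. Hence `σ (x + y) = x + y` and
`σ (x y) = a x y + b y x`, while `φ` is a field automorphism; injectivity of `σ` gives `a² ≠ b²`.
Thus `σ` is the twist with parameters `(a b; b a) ∈ G` and `φ ∈ Aut k`.

Conversely each pair in `G ⋊ Aut k` has a twist (`twistFun`), composition of twists is the
multiplication of `G ⋊ Aut k`, and conjugation by twists is a homomorphism (`twistAut`) from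
`G ⋊ Aut k` to the automorphisms of `Θ⁰`, surjective modulo the inner ones. A natural isomorphism
from a conjugation by twists to the identity, composed with the twists, is multiplication by a
scalar (`exists_app_twist_eq_smul`); this forces `φ = 1` and `b = 0`, and these conditions suffice. So both
`𝔄 / 𝔜` and `(G / k* I₂) ⋊ Aut k` are the quotient of `G ⋊ Aut k` by the scalar matrices. The group
`G` is the unit group of `k S₂` by `(a b; b a) ↦ a e + b (12)`, and the matrices `(1 c; c 1)` give
infinitely many classes in `G / k* I₂`.
-/

noncomputable section

namespace LinearAlgebras

universe u v w

/-! ### Coefficients in a free linear algebra -/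

section Coefficients

variable {k : Type u} [Field k] {X : Type v}

local notation "𝔽" => FreeNonUnitalNonAssocAlgebra k

theorem coeff_of (x : X) :
    (FreeNonUnitalNonAssocAlgebra.of k x).coeff = Finsupp.single (FreeMagma.of x) 1 := rfl

theorem of_mul_ne_mul (x : X) (a b : FreeMagma X) : FreeMagma.of x ≠ a * b := by
  intro h
  cases h

theorem mul_inj_mul {a b a' b' : FreeMagma X} : a * b = a' * b' ↔ a = a' ∧ b = b' := by
  constructor
  · intro h
    cases h
    exact ⟨rfl, rfl⟩
  · rintro ⟨rfl, rfl⟩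
    rfl

theorem of_inj_of {x y : X} : FreeMagma.of x = FreeMagma.of y ↔ x = y := by
  constructor
  · intro h
    cases h
    rfl
  · rintro rfl
    rfl

theorem coeff_mul_of (u v : 𝔽 X) (x : X) : (u * v).coeff (FreeMagma.of x) = 0 := by
  classical
  rw [MonoidAlgebra.coeff_mul]
  refine Finset.sum_eq_zero fun a _ => Finset.sum_eq_zero fun b _ => ?_
  exact if_neg (of_mul_ne_mul x a b).symm

/-- In a free magma a product determines its factors, so the coefficients of a product are products
of coefficients. -/
theorem coeff_mul_mul (u v : 𝔽 X) (a b : FreeMagma X) :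
    (u * v).coeff (a * b) = u.coeff a * v.coeff b := by
  classical
  induction u using MonoidAlgebra.induction_linear with
  | zero => simp
  | add u u' hu hu' => simp [add_mul, hu, hu']
  | single m c =>
    induction v using MonoidAlgebra.induction_linear with
    | zero => simp
    | add v v' hv hv' => simp [mul_add, hv, hv']
    | single n d =>
      rw [MonoidAlgebra.single_mul_single]
      simp only [MonoidAlgebra.coeff_single, Finsupp.single_apply, mul_inj_mul]
      by_cases h : m = a <;> by_cases h' : n = b <;> simp [h, h']

theorem free_induction {motive : 𝔽 X → Prop} (u : 𝔽 X)
    (of : ∀ x, motive (FreeNonUnitalNonAssocAlgebra.of k x))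
    (add : ∀ u v, motive u → motive v → motive (u + v))
    (smul : ∀ (c : k) u, motive u → motive (c • u))
    (mul : ∀ u v, motive u → motive v → motive (u * v))
    (zero : motive 0) : motive u := by
  induction u using MonoidAlgebra.induction_linear with
  | zero => exact zero
  | add u v hu hv => exact add u v hu hv
  | single m c =>
    have h : (MonoidAlgebra.single m c : 𝔽 X) = c • MonoidAlgebra.single m 1 := by simp
    rw [h]
    refine smul c _ ?_
    induction m with
    | ih1 x => exact of x
    | ih2 a b ha hb =>
      have := mul _ _ (ha (by simp)) (hb (by simp))
      rwa [MonoidAlgebra.single_mul_single, one_mul] at this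

theorem single_mul_one (a b : FreeMagma X) :
    (MonoidAlgebra.single (a * b) 1 : 𝔽 X) =
      MonoidAlgebra.single a 1 * MonoidAlgebra.single b 1 := by
  rw [MonoidAlgebra.single_mul_single, one_mul]

theorem coeff_map_eq_sum {Y : Type w} (f : 𝔽 X →ₙₐ[k] 𝔽 Y) (u : 𝔽 X) (n : FreeMagma Y) :
    (f u).coeff n = u.coeff.sum fun m c => c * (f (MonoidAlgebra.single m 1)).coeff n := by
  induction u using MonoidAlgebra.induction_linear with
  | zero => simp
  | add u v hu hv =>
    rw [map_add, MonoidAlgebra.coeff_add, Finsupp.add_apply, hu, hv, MonoidAlgebra.coeff_add,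
      Finsupp.sum_add_index']
    · simp
    · intros; ring
  | single m c =>
    have h : (MonoidAlgebra.single m c : 𝔽 X) = c • MonoidAlgebra.single m 1 := by simp
    rw [h, map_smul, MonoidAlgebra.coeff_smul_apply, ← h, MonoidAlgebra.coeff_single,
      Finsupp.sum_single_index] <;> simp

/-! ### Rescaling the generators -/

/-- The degree of a nonassociative monomial when the generator `x` has degree `wt x`. -/
def weight (wt : X → ℕ) : FreeMagma X → ℕ
  | FreeMagma.of x => wt x
  | FreeMagma.mul a b => weight wt a + weight wt b

@[simp] theorem weight_of (wt : X → ℕ) (x : X) : weight wt (FreeMagma.of x) = wt x := rfl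

@[simp] theorem weight_mul (wt : X → ℕ) (a b : FreeMagma X) :
    weight wt (a * b) = weight wt a + weight wt b := rfl

theorem weight_add (wt wt' : X → ℕ) (m : FreeMagma X) :
    weight (wt + wt') m = weight wt m + weight wt' m := by
  induction m with
  | ih1 x => rfl
  | ih2 a b ha hb => simp only [weight_mul, ha, hb]; ring

theorem weight_one_pos (m : FreeMagma X) : 0 < weight 1 m := by
  induction m with
  | ih1 x => exact Nat.one_pos
  | ih2 a b ha hb => exact Nat.add_pos_left ha _

theorem exists_eq_of_weight_eq_one {m : FreeMagma X} (h : weight 1 m = 1) :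
    ∃ x, m = FreeMagma.of x := by
  induction m with
  | ih1 x => exact ⟨x, rfl⟩
  | ih2 a b =>
    have ha := weight_one_pos a
    have hb := weight_one_pos b
    rw [weight_mul] at h
    omega

theorem coeff_rescale (wt : X → ℕ) (c : k) (u : 𝔽 X) (m : FreeMagma X) :
    (FreeNonUnitalNonAssocAlgebra.lift k
      (fun x => c ^ wt x • FreeNonUnitalNonAssocAlgebra.of k x) u).coeff m =
        c ^ weight wt m * u.coeff m := by
  classical
  revert m
  induction u using free_induction with
  | of x =>
    intro m
    rw [FreeNonUnitalNonAssocAlgebra.lift_of_apply, MonoidAlgebra.coeff_smul_apply, coeff_of,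
      Finsupp.single_apply, smul_eq_mul]
    by_cases h : FreeMagma.of x = m
    · subst h; simp
    · simp [h]
  | add u v hu hv => intro m; simp [hu, hv, mul_add]
  | smul d u hu => intro m; simp [hu]; ring
  | mul u v hu hv =>
    intro m
    rw [map_mul]
    induction m with
    | ih1 x => simp [coeff_mul_of]
    | ih2 a b => rw [coeff_mul_mul, coeff_mul_mul, hu, hv, weight_mul]; ring
  | zero => simp

/-- Over an infinite field, an element which is multiplied by `c` whenever the generators are
rescaled by `c ^ wt x` only involves monomials of degree one. -/
theorem weight_eq_one_of_rescale [Infinite k] (wt : X → ℕ) (u : 𝔽 X)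
    (h : ∀ c : k, FreeNonUnitalNonAssocAlgebra.lift k
      (fun x => c ^ wt x • FreeNonUnitalNonAssocAlgebra.of k x) u = c • u)
    {m : FreeMagma X} (hm : u.coeff m ≠ 0) : weight wt m = 1 := by
  have h1 : ∀ c : k, c ^ weight wt m = c := by
    intro c
    have := congrArg (fun v : 𝔽 X => v.coeff m) (h c)
    simp only [coeff_rescale, MonoidAlgebra.coeff_smul_apply, smul_eq_mul] at this
    exact mul_right_cancel₀ hm this
  have h2 : (Polynomial.X ^ weight wt m : Polynomial k) = Polynomial.X :=
    Polynomial.funext fun c => by simpa using h1 c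
  simpa using congrArg Polynomial.natDegree h2

/-! ### Invertible substitutions in one variable -/

theorem weight_lift_const (t m : FreeMagma X) :
    weight 1 (FreeMagma.lift (fun _ => t) m) = weight 1 m * weight 1 t := by
  induction m with
  | ih1 x => simp
  | ih2 a b ha hb => rw [map_mul, weight_mul, ha, hb, weight_mul, add_mul]

theorem coeff_lift_const_self (q : 𝔽 X) (t m : FreeMagma X) :
    (FreeNonUnitalNonAssocAlgebra.lift k (fun _ => q)
      (MonoidAlgebra.single m 1)).coeff (FreeMagma.lift (fun _ => t) m) =
        q.coeff t ^ weight 1 m := by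
  induction m with
  | ih1 x =>
    rw [show (MonoidAlgebra.single (FreeMagma.of x) 1 : 𝔽 X) =
      FreeNonUnitalNonAssocAlgebra.of k x from rfl,
      FreeNonUnitalNonAssocAlgebra.lift_of_apply]
    simp
  | ih2 a b ha hb =>
    rw [single_mul_one, map_mul, map_mul, coeff_mul_mul, ha, hb, weight_mul, pow_add]

/-- Let `t` be a monomial of top degree in `q`. Among the results of substituting `q` into monomials
`m'` of degree at most that of `m`, only the one with `m' = m` involves the monomial `m(t)`. -/
theorem coeff_lift_const_of_ne [Subsingleton X] {q : 𝔽 X} {t : FreeMagma X}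
    (htop : ∀ s, q.coeff s ≠ 0 → weight 1 s ≤ weight 1 t) (m' : FreeMagma X) :
    ∀ m : FreeMagma X, weight 1 m' ≤ weight 1 m → m' ≠ m →
      (FreeNonUnitalNonAssocAlgebra.lift k (fun _ => q)
        (MonoidAlgebra.single m' 1)).coeff (FreeMagma.lift (fun _ => t) m) = 0 := by
  induction m' with
  | ih1 x =>
    intro m _ hne
    rw [show (MonoidAlgebra.single (FreeMagma.of x) 1 : 𝔽 X) =
        FreeNonUnitalNonAssocAlgebra.of k x from rfl,
      FreeNonUnitalNonAssocAlgebra.lift_of_apply]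
    by_contra hc
    have h1 := htop _ hc
    rw [weight_lift_const] at h1
    have h2 := weight_one_pos t
    have h3 := weight_one_pos m
    have h4 : weight 1 m = 1 := by
      have : weight 1 m ≤ 1 := by
        by_contra hlt
        nlinarith
      omega
    obtain ⟨y, rfl⟩ := exists_eq_of_weight_eq_one h4
    exact hne (congrArg _ (Subsingleton.elim _ _))
  | ih2 a' b' iha ihb =>
    intro m hle hne
    rw [single_mul_one, map_mul]
    induction m with
    | ih1 x =>
      have := weight_one_pos a'
      have := weight_one_pos b'
      simp only [weight_mul, weight_of, Pi.one_apply] at hle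
      omega
    | ih2 a b =>
      rw [map_mul, coeff_mul_mul]
      rw [weight_mul, weight_mul] at hle
      have key : (weight 1 a' ≤ weight 1 a ∧ a' ≠ a) ∨ (weight 1 b' ≤ weight 1 b ∧ b' ≠ b) := by
        by_cases h1 : weight 1 a' ≤ weight 1 a
        · by_cases h2 : a' = a
          · subst h2
            refine Or.inr ⟨by omega, ?_⟩
            rintro rfl
            exact hne rfl
          · exact Or.inl ⟨h1, h2⟩
        · refine Or.inr ⟨by omega, ?_⟩
          rintro rfl
          omega
      rcases key with ⟨h, h'⟩ | ⟨h, h'⟩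
      · rw [iha a h h', zero_mul]
      · rw [ihb b h h', mul_zero]

theorem exists_top_coeff {u : 𝔽 X} (hu : u ≠ 0) :
    ∃ t, u.coeff t ≠ 0 ∧ ∀ s, u.coeff s ≠ 0 → weight 1 s ≤ weight 1 t := by
  have hne : u.coeff.support.Nonempty := by
    rw [Finsupp.support_nonempty_iff]
    exact fun h => hu (MonoidAlgebra.coeff_eq_zero.1 h)
  obtain ⟨t, ht, hmax⟩ := u.coeff.support.exists_max_image (weight 1) hne
  exact ⟨t, by simpa using ht, fun s hs => hmax s (by simpa using hs)⟩

/-- A polynomial in one variable with a compositional inverse is linear. -/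
theorem eq_smul_of_of_lift_const_eq_of [Subsingleton X] (x : X) {p q : 𝔽 X}
    (h : FreeNonUnitalNonAssocAlgebra.lift k (fun _ => q) p =
      FreeNonUnitalNonAssocAlgebra.of k x) :
    q = q.coeff (FreeMagma.of x) • FreeNonUnitalNonAssocAlgebra.of k x := by
  classical
  have hof : FreeNonUnitalNonAssocAlgebra.of k x ≠ 0 := by
    intro h0
    have := congrArg (fun v : 𝔽 X => v.coeff (FreeMagma.of x)) h0
    simp [coeff_of] at this
  have hp : p ≠ 0 := by
    rintro rfl
    exact hof (by rw [← h, map_zero])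
  have hq : q ≠ 0 := by
    rintro rfl
    refine hof (h.symm.trans ?_)
    have : (FreeNonUnitalNonAssocAlgebra.lift k (fun _ : X => (0 : 𝔽 X))) = 0 :=
      FreeNonUnitalNonAssocAlgebra.hom_ext k fun y => by
        rw [FreeNonUnitalNonAssocAlgebra.lift_of_apply]; rfl
    rw [this]; rfl
  obtain ⟨t, ht, htop⟩ := exists_top_coeff hq
  obtain ⟨m, hm, hmtop⟩ := exists_top_coeff hp
  have hc := coeff_map_eq_sum (FreeNonUnitalNonAssocAlgebra.lift k (fun _ => q)) p
    (FreeMagma.lift (fun _ => t) m)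
  rw [h, Finsupp.sum_eq_single m, coeff_lift_const_self, coeff_of,
    Finsupp.single_apply] at hc
  · have hmt : FreeMagma.of x = FreeMagma.lift (fun _ => t) m := by
      by_contra hne
      rw [if_neg hne] at hc
      exact mul_ne_zero hm (pow_ne_zero _ ht) hc.symm
    have hw := congrArg (weight 1) hmt
    rw [weight_lift_const, weight_of, Pi.one_apply] at hw
    have ht1 : weight 1 t = 1 := Nat.eq_one_of_mul_eq_one_left hw.symm
    refine MonoidAlgebra.ext (Finsupp.ext fun s => ?_)
    rw [MonoidAlgebra.coeff_smul_apply, coeff_of, Finsupp.single_apply]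
    split_ifs with hs
    · simp [hs]
    · by_contra hs0
      rw [smul_zero] at hs0
      have h1 := htop s hs0
      have h2 := weight_one_pos s
      obtain ⟨y, rfl⟩ := exists_eq_of_weight_eq_one (m := s) (by omega)
      exact hs (congrArg _ (Subsingleton.elim _ _))
  · intro m' hm' hne
    rw [coeff_lift_const_of_ne htop m' m (hmtop m' hm') hne, mul_zero]
  · intro _; simp

end Coefficients

/-! ### Twists of a free linear algebra -/

section Twist

variable {k : Type u} [Field k] {X : Type v}

local notation "𝔽" => FreeNonUnitalNonAssocAlgebra k

/-- `s` fixes the generators of the free algebra and is a homomorphism to the algebra with the same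
addition, with scalar multiplication `c * u = φ(c) u` and with multiplication
`u × v = a u v + b v u`. -/
structure IsTwist (a b : k) (φ : RingAut k) (s : 𝔽 X → 𝔽 X) : Prop where
  of : ∀ x, s (FreeNonUnitalNonAssocAlgebra.of k x) = FreeNonUnitalNonAssocAlgebra.of k x
  add : ∀ u v, s (u + v) = s u + s v
  smul : ∀ (c : k) u, s (c • u) = φ c • s u
  mul : ∀ u v, s (u * v) = a • (s u * s v) + b • (s v * s u)

theorem IsTwist.zero {a b : k} {φ : RingAut k} {s : 𝔽 X → 𝔽 X} (h : IsTwist a b φ s) :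
    s 0 = 0 := by
  simpa using h.add 0 0

theorem IsTwist.unique {a b : k} {φ : RingAut k} {s t : 𝔽 X → 𝔽 X} (hs : IsTwist a b φ s)
    (ht : IsTwist a b φ t) : s = t := by
  funext u
  induction u using free_induction with
  | of x => rw [hs.of, ht.of]
  | add u v hu hv => rw [hs.add, ht.add, hu, hv]
  | smul c u hu => rw [hs.smul, ht.smul, hu]
  | mul u v hu hv => rw [hs.mul, ht.mul, hu, hv]
  | zero => rw [hs.zero, ht.zero]

theorem IsTwist.id : IsTwist (1 : k) 0 1 (id : 𝔽 X → 𝔽 X) where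
  of _ := rfl
  add _ _ := rfl
  smul _ _ := rfl
  mul _ _ := by simp

theorem IsTwist.comp {a b c d : k} {φ ψ : RingAut k} {s t : 𝔽 X → 𝔽 X} (hs : IsTwist a b φ s)
    (ht : IsTwist c d ψ t) :
    IsTwist (a * φ c + b * φ d) (a * φ d + b * φ c) (φ * ψ) (s ∘ t) where
  of x := by simp [hs.of, ht.of]
  add u v := by simp [hs.add, ht.add]
  smul c u := by simp [hs.smul, ht.smul]
  mul u v := by
    simp only [Function.comp_apply, ht.mul, hs.add, hs.smul, hs.mul]
    module

/-- The image of a monomial under a twist. -/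
def twistMonomial (a b : k) : FreeMagma X → 𝔽 X
  | FreeMagma.of x => FreeNonUnitalNonAssocAlgebra.of k x
  | FreeMagma.mul m n => a • (twistMonomial a b m * twistMonomial a b n) +
      b • (twistMonomial a b n * twistMonomial a b m)

/-- The twist with parameters `a`, `b`, `φ`, as an additive map. -/
def twistFun (a b : k) (φ : RingAut k) : 𝔽 X →+ 𝔽 X :=
  (Finsupp.liftAddHom fun m =>
    ((smulAddHom k (𝔽 X)).flip (twistMonomial a b m)).comp
      (φ : k →+* k).toAddMonoidHom).comp (MonoidAlgebra.coeffAddEquiv).toAddMonoidHom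

theorem twistFun_single (a b : k) (φ : RingAut k) (m : FreeMagma X) (c : k) :
    twistFun a b φ (MonoidAlgebra.single m c) = φ c • twistMonomial a b m := by
  change Finsupp.liftAddHom _ (Finsupp.single m c) = _
  rw [Finsupp.liftAddHom_apply_single]
  rfl

theorem isTwist_twistFun (a b : k) (φ : RingAut k) :
    IsTwist a b φ (twistFun a b φ : 𝔽 X → 𝔽 X) where
  of x := by
    have := twistFun_single a b φ (FreeMagma.of x) 1
    rw [map_one, one_smul] at this
    exact this
  add := map_add _
  smul c u := by
    induction u using MonoidAlgebra.induction_linear with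
    | zero => simp
    | add u v hu hv => simp [hu, hv]
    | single m d => simp [twistFun_single, mul_smul]
  mul u v := by
    induction u using MonoidAlgebra.induction_linear with
    | zero => simp
    | add u u' hu hu' =>
      rw [add_mul, map_add, map_add, hu, hu', add_mul, mul_add]
      module
    | single m c =>
      induction v using MonoidAlgebra.induction_linear with
      | zero => simp
      | add v v' hv hv' =>
        rw [mul_add, map_add, map_add, hv, hv', add_mul, mul_add]
        module
      | single n d =>
        have h : twistMonomial a b (m * n) =
          a • (twistMonomial a b m * twistMonomial a b n) +
            b • (twistMonomial a b n * twistMonomial a b m) := rfl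
        rw [MonoidAlgebra.single_mul_single]
        simp only [twistFun_single, h, smul_mul_smul_comm, map_mul]
        module

/-- Conjugation by twists carries a homomorphism `f` of free algebras to a homomorphism, namely to
the one with the prescribed values on the generators. -/
theorem lift_twist_apply {Y : Type w} {a b : k} {φ : RingAut k} {s : 𝔽 X → 𝔽 X} {t : 𝔽 Y → 𝔽 Y}
    (hs : IsTwist a b φ s) (ht : IsTwist a b φ t) (f : 𝔽 X →ₙₐ[k] 𝔽 Y) (u : 𝔽 X) :
    FreeNonUnitalNonAssocAlgebra.lift k
      (fun x => t (f (FreeNonUnitalNonAssocAlgebra.of k x))) (s u) = t (f u) := by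
  induction u using free_induction with
  | of x => rw [hs.of, FreeNonUnitalNonAssocAlgebra.lift_of_apply]
  | add u v hu hv => rw [hs.add, map_add, map_add, ht.add, hu, hv]
  | smul c u hu => rw [hs.smul, map_smul, map_smul, ht.smul, hu]
  | mul u v hu hv =>
    rw [hs.mul, map_add, map_smul, map_smul, map_mul, map_mul, map_mul, ht.mul, hu, hv]
  | zero => rw [hs.zero, map_zero, map_zero, ht.zero]

variable (k) in
/-- The group `G ⋊ Aut k` of parameters of twists. -/
abbrev Param := matG k ⋊[autActG k] RingAut k

/-- The diagonal entry `a` of the matrix `(a b; b a)` of a parameter. -/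
def Param.a (p : Param k) : k := (p.left : GL (Fin 2) k).1 0 0

/-- The off-diagonal entry `b` of the matrix `(a b; b a)` of a parameter. -/
def Param.b (p : Param k) : k := (p.left : GL (Fin 2) k).1 0 1

theorem matG_coe (g : matG k) : ((g : GL (Fin 2) k) : Matrix (Fin 2) (Fin 2) k) =
    !![(g : GL (Fin 2) k).1 0 0, (g : GL (Fin 2) k).1 0 1;
      (g : GL (Fin 2) k).1 0 1, (g : GL (Fin 2) k).1 0 0] := by
  obtain ⟨g, a, b, h⟩ := g
  simp [h]

theorem Param.coe_left (p : Param k) :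
    ((p.left : GL (Fin 2) k) : Matrix (Fin 2) (Fin 2) k) = !![p.a, p.b; p.b, p.a] :=
  matG_coe _

theorem Param.coe_mul_left (p q : Param k) :
    (((p * q).left : GL (Fin 2) k) : Matrix (Fin 2) (Fin 2) k) =
      !![p.a, p.b; p.b, p.a] *
        !![p.right q.a, p.right q.b; p.right q.b, p.right q.a] := by
  change ((p.left : GL (Fin 2) k) : Matrix (Fin 2) (Fin 2) k) *
    ((q.left : GL (Fin 2) k) : Matrix (Fin 2) (Fin 2) k).map p.right = _
  rw [p.coe_left, q.coe_left]
  congr 1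
  ext i j
  fin_cases i <;> fin_cases j <;> rfl

theorem Param.mul_a (p q : Param k) : (p * q).a = p.a * p.right q.a + p.b * p.right q.b := by
  rw [Param.a, Param.coe_mul_left]
  simp [Matrix.mul_apply]

theorem Param.mul_b (p q : Param k) : (p * q).b = p.a * p.right q.b + p.b * p.right q.a := by
  rw [Param.b, Param.coe_mul_left]
  simp [Matrix.mul_apply]

/-- Twists, as an action of the group of parameters on the free algebra by permutations. -/
def twist (X : Type v) : Param k →* Equiv.Perm (𝔽 X) :=
  MonoidHom.toHomPerm
    { toFun := fun p => (twistFun p.a p.b p.right : 𝔽 X → 𝔽 X)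
      map_one' := (isTwist_twistFun _ _ _).unique IsTwist.id
      map_mul' := fun p q => by
        refine (isTwist_twistFun _ _ _).unique ?_
        rw [Param.mul_a, Param.mul_b]
        exact (isTwist_twistFun _ _ _).comp (isTwist_twistFun _ _ _) }

theorem isTwist_twist (p : Param k) : IsTwist p.a p.b p.right (twist X p) :=
  isTwist_twistFun _ _ _

end Twist

/-! ### The automorphisms of the category given by twists -/

section TwistFunctor

variable {k : Type u} [Field k]

/-- The free generator of `F(X)` given by `x ∈ X`. -/
abbrev FreeAlg.gen {X : FreeAlg k} (x : X.gens) : X.carrier := FreeNonUnitalNonAssocAlgebra.of k x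

/-- The homomorphism out of `F(X)` with prescribed values on the generators. -/
abbrev FreeAlg.desc {X Y : FreeAlg k} (f : X.gens → Y.carrier) : X ⟶ Y :=
  FreeNonUnitalNonAssocAlgebra.lift k f

/-- A morphism of `Θ⁰` as a function; the hom type of the category carries no coercion to functions
of its own. -/
abbrev FreeAlg.app {X Y : FreeAlg k} (f : X ⟶ Y) (u : X.carrier) : Y.carrier :=
  (show X.carrier →ₙₐ[k] Y.carrier from f) u

open FreeAlg

theorem app_desc_gen {X Y : FreeAlg k} (f : X.gens → Y.carrier) (x : X.gens) :
    app (desc f) (gen x) = f x :=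
  FreeNonUnitalNonAssocAlgebra.lift_of_apply k f x

theorem FreeAlg.hom_ext_gen {X Y : FreeAlg k} {f g : X ⟶ Y}
    (h : ∀ x : X.gens, app f (gen x) = app g (gen x)) : f = g :=
  FreeNonUnitalNonAssocAlgebra.hom_ext k h

theorem app_comp {X Y Z : FreeAlg k} (f : X ⟶ Y) (g : Y ⟶ Z) (u : X.carrier) :
    app (f ≫ g) u = app g (app f u) := rfl

theorem app_id {X : FreeAlg k} (u : X.carrier) : app (𝟙 X) u = u := rfl

theorem app_add {X Y : FreeAlg k} (f : X ⟶ Y) (u v : X.carrier) :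
    app f (u + v) = app f u + app f v :=
  map_add (show X.carrier →ₙₐ[k] Y.carrier from f) u v

theorem app_smul {X Y : FreeAlg k} (f : X ⟶ Y) (c : k) (u : X.carrier) :
    app f (c • u) = c • app f u :=
  map_smul (show X.carrier →ₙₐ[k] Y.carrier from f) c u

theorem app_mul {X Y : FreeAlg k} (f : X ⟶ Y) (u v : X.carrier) :
    app f (u * v) = app f u * app f v :=
  map_mul (show X.carrier →ₙₐ[k] Y.carrier from f) u v

theorem app_zero {X Y : FreeAlg k} (f : X ⟶ Y) : app f 0 = 0 :=
  map_zero (show X.carrier →ₙₐ[k] Y.carrier from f)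

/-- Conjugation by twists on morphisms: `f ↦ s_Y ∘ f ∘ s_X⁻¹`. -/
def twistMap (p : Param k) {X Y : FreeAlg k} (f : X ⟶ Y) : X ⟶ Y :=
  desc fun x => twist Y.gens p (app f (gen x))

theorem app_twistMap_gen (p : Param k) {X Y : FreeAlg k} (f : X ⟶ Y) (x : X.gens) :
    app (twistMap p f) (gen x) = twist Y.gens p (app f (gen x)) :=
  app_desc_gen _ _

theorem app_twistMap_twist (p : Param k) {X Y : FreeAlg k} (f : X ⟶ Y) (u : X.carrier) :
    app (twistMap p f) (twist X.gens p u) = twist Y.gens p (app f u) :=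
  lift_twist_apply (isTwist_twist p) (isTwist_twist p) f u

/-- The endofunctor of `Θ⁰` which is the identity on objects and is conjugation by twists on
morphisms. -/
def twistFunctor (p : Param k) : FreeAlg k ⥤ FreeAlg k where
  obj X := X
  map f := twistMap p f
  map_id X := FreeAlg.hom_ext_gen fun x => by
    rw [app_twistMap_gen, app_id, (isTwist_twist p).of]
  map_comp f g := FreeAlg.hom_ext_gen fun x => by
    rw [app_twistMap_gen, app_comp, app_comp, app_twistMap_gen, app_twistMap_twist]

theorem twistMap_one {X Y : FreeAlg k} (f : X ⟶ Y) : twistMap 1 f = f :=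
  FreeAlg.hom_ext_gen fun x => by
    rw [app_twistMap_gen, map_one]
    rfl

theorem twistMap_mul (p q : Param k) {X Y : FreeAlg k} (f : X ⟶ Y) :
    twistMap (p * q) f = twistMap p (twistMap q f) :=
  FreeAlg.hom_ext_gen fun x => by
    rw [app_twistMap_gen, app_twistMap_gen, app_twistMap_gen, map_mul]
    rfl

theorem twistFunctor_one : twistFunctor (1 : Param k) = 𝟭 (FreeAlg k) :=
  Functor.hext (fun _ => rfl) fun _ _ f => heq_of_eq (twistMap_one f)

theorem twistFunctor_mul (p q : Param k) :
    twistFunctor (p * q) = twistFunctor q ⋙ twistFunctor p :=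
  Functor.hext (fun _ => rfl) fun _ _ f => heq_of_eq (twistMap_mul p q f)

variable (k) in
/-- The homomorphism from the group of parameters to the group of automorphisms of `Θ⁰`. -/
def twistAut : Param k →* CatAut (FreeAlg k) where
  toFun p :=
    { hom := (twistFunctor p).toCatHom
      inv := (twistFunctor p⁻¹).toCatHom
      hom_inv_id := Cat.ext (by
        change twistFunctor p ⋙ twistFunctor p⁻¹ = 𝟭 _
        rw [← twistFunctor_mul, inv_mul_cancel, twistFunctor_one])
      inv_hom_id := Cat.ext (by
        change twistFunctor p⁻¹ ⋙ twistFunctor p = 𝟭 _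
        rw [← twistFunctor_mul, mul_inv_cancel, twistFunctor_one]) }
  map_one' := Aut.ext (Cat.ext twistFunctor_one)
  map_mul' p q := Aut.ext (Cat.ext (twistFunctor_mul p q))

end TwistFunctor

/-! ### Bijections compatible with all substitutions are twists -/

section Generators

variable {k : Type u}

variable (k) in
/-- The object `F(x)`. -/
abbrev one : FreeAlg k := ⟨{0}⟩

variable (k) in
/-- The object `F(x, y)`. -/
abbrev two : FreeAlg k := ⟨{0, 1}⟩

/-- The generator of `F(x)`. -/
abbrev x₁ : (one k).gens := ⟨0, by simp⟩

/-- The first generator of `F(x, y)`. -/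
abbrev x₂ : (two k).gens := ⟨0, by simp⟩

/-- The second generator of `F(x, y)`. -/
abbrev y₂ : (two k).gens := ⟨1, by simp⟩

instance : Subsingleton (one k).gens :=
  ⟨fun a b => Subtype.ext ((Finset.mem_singleton.1 a.2).trans (Finset.mem_singleton.1 b.2).symm)⟩

theorem two_gens_cases (z : (two k).gens) : z = x₂ ∨ z = y₂ := by
  obtain ⟨z, hz⟩ := z
  simpa [Subtype.ext_iff] using hz

theorem x₂_ne_y₂ : (x₂ : (two k).gens) ≠ y₂ := by simp [Subtype.ext_iff]

end Generators

section Verbal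

variable {k : Type u} [Field k]

open FreeAlg

/-- A family of permutations of all free algebras which fixes the generators and turns substitutions
into substitutions. -/
structure IsVerbal (σ : ∀ X : FreeAlg k, Equiv.Perm X.carrier) : Prop where
  map_gen : ∀ (X : FreeAlg k) (x : X.gens), σ X (gen x) = gen x
  map_desc : ∀ (X Y : FreeAlg k) (g : X.gens → Y.carrier) (u : X.carrier),
    σ Y (app (desc g) u) = app (desc fun x => σ Y (g x)) (σ X u)

theorem IsVerbal.symm {σ : ∀ X : FreeAlg k, Equiv.Perm X.carrier} (h : IsVerbal σ) :
    IsVerbal fun X => (σ X).symm where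
  map_gen X x := by rw [Equiv.symm_apply_eq, h.map_gen]
  map_desc X Y g u := by
    rw [Equiv.symm_apply_eq, h.map_desc]
    simp only [Equiv.apply_symm_apply]

theorem gen_ne_zero {X : FreeAlg k} (x : X.gens) : gen x ≠ 0 := by
  intro h
  have := congrArg (fun v : X.carrier => v.coeff (FreeMagma.of x)) h
  simp [coeff_of] at this

/-- The homomorphism `F(x) → F(Y)` with `x ↦ u`. -/
abbrev eval₁ {Y : FreeAlg k} (u : Y.carrier) : one k ⟶ Y := desc fun _ => u

/-- The function on the generators of `F(x, y)` with values `u` and `v`. -/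
def pair {α : Type*} (u v : α) (z : (two k).gens) : α := if z = x₂ then u else v

/-- The homomorphism `F(x, y) → F(Y)` with `x ↦ u` and `y ↦ v`. -/
abbrev eval₂ {Y : FreeAlg k} (u v : Y.carrier) : two k ⟶ Y := desc (pair u v)

theorem eval₁_gen {Y : FreeAlg k} (u : Y.carrier) : app (eval₁ u) (gen x₁) = u :=
  app_desc_gen _ _

theorem eval₂_x {Y : FreeAlg k} (u v : Y.carrier) : app (eval₂ u v) (gen x₂) = u :=
  (app_desc_gen _ _).trans (if_pos rfl)

theorem eval₂_y {Y : FreeAlg k} (u v : Y.carrier) : app (eval₂ u v) (gen y₂) = v :=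
  (app_desc_gen _ _).trans (if_neg x₂_ne_y₂.symm)

/-- An element of degree one in `F(x, y)` is linear. -/
theorem eq_linear_of_weight {w : (two k).carrier} (h : ∀ m, w.coeff m ≠ 0 → weight 1 m = 1) :
    ∃ α β : k, w = α • gen x₂ + β • gen y₂ := by
  classical
  refine ⟨w.coeff (FreeMagma.of x₂), w.coeff (FreeMagma.of y₂),
    MonoidAlgebra.ext (Finsupp.ext fun m => ?_)⟩
  simp only [MonoidAlgebra.coeff_add, Finsupp.add_apply, MonoidAlgebra.coeff_smul_apply, coeff_of,
    Finsupp.single_apply, smul_eq_mul]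
  by_cases hm : w.coeff m = 0
  · rw [hm]
    by_cases h1 : FreeMagma.of x₂ = m <;> by_cases h2 : FreeMagma.of y₂ = m <;> simp_all
  · obtain ⟨z, rfl⟩ := exists_eq_of_weight_eq_one (h m hm)
    rcases two_gens_cases z with rfl | rfl <;> simp [of_inj_of, x₂_ne_y₂.symm]

/-- An element of degree one in each of the variables of `F(x, y)` is a combination of `x y` and
`y x`. -/
theorem eq_bilinear_of_weight {w : (two k).carrier}
    (hx : ∀ m, w.coeff m ≠ 0 → weight (pair 1 0) m = 1)
    (hy : ∀ m, w.coeff m ≠ 0 → weight (pair 0 1) m = 1) :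
    ∃ a b : k, w = a • (gen x₂ * gen y₂) + b • (gen y₂ * gen x₂) := by
  classical
  refine ⟨w.coeff (FreeMagma.of x₂ * FreeMagma.of y₂), w.coeff (FreeMagma.of y₂ * FreeMagma.of x₂),
    MonoidAlgebra.ext (Finsupp.ext fun m => ?_)⟩
  have hsum : (pair 1 0 + pair 0 1 : (two k).gens → ℕ) = 1 := by
    funext z
    rcases two_gens_cases z with rfl | rfl <;> simp [pair]
  simp only [MonoidAlgebra.coeff_add, Finsupp.add_apply, MonoidAlgebra.coeff_smul_apply,
    smul_eq_mul]
  induction m with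
  | ih1 z =>
    simp only [coeff_mul_of, mul_zero, add_zero]
    by_contra hm
    have h1 := hx _ hm
    have h2 := hy _ hm
    rw [weight_of] at h1 h2
    have h3 := congrFun hsum z
    rw [Pi.add_apply, h1, h2] at h3
    simp at h3
  | ih2 m n =>
    simp only [coeff_mul_mul, coeff_of, Finsupp.single_apply]
    by_cases hm : w.coeff (m * n) = 0
    · by_cases h1 : FreeMagma.of x₂ = m <;> by_cases h2 : FreeMagma.of y₂ = m <;>
        by_cases h3 : FreeMagma.of x₂ = n <;> by_cases h4 : FreeMagma.of y₂ = n <;> simp_all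
    · have h1 := hx _ hm
      have h2 := hy _ hm
      rw [weight_mul] at h1 h2
      have hm1 := weight_add (pair 1 0) (pair 0 1) m
      have hn1 := weight_add (pair 1 0) (pair 0 1) n
      rw [hsum] at hm1 hn1
      have hm0 := weight_one_pos m
      have hn0 := weight_one_pos n
      obtain ⟨z, rfl⟩ := exists_eq_of_weight_eq_one (m := m) (by omega)
      obtain ⟨z', rfl⟩ := exists_eq_of_weight_eq_one (m := n) (by omega)
      rcases two_gens_cases z with rfl | rfl <;> rcases two_gens_cases z' with rfl | rfl <;>
        simp_all [of_inj_of, pair]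

theorem eq_zero_of_gens_empty {E : FreeAlg k} (hE : E.gens = ∅) (u : E.carrier) : u = 0 := by
  refine MonoidAlgebra.ext (Finsupp.ext fun m => ?_)
  have : ∀ _ : FreeMagma E.gens, False := by
    intro m
    induction m with
    | ih1 x => exact Finset.notMem_empty x.1 (by rw [← hE]; exact x.2)
    | ih2 _ _ ha _ => exact ha
  exact (this m).elim

theorem gen_mul_gen_ne_smul (c : k) :
    (gen x₂ * gen y₂ : (two k).carrier) ≠ c • (gen y₂ * gen x₂) := by
  classical
  intro h
  have := congrArg
    (fun v : (two k).carrier => v.coeff (FreeMagma.of x₂ * FreeMagma.of y₂)) h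
  simp [coeff_mul_mul, coeff_of, of_inj_of] at this

theorem eval₂_pair_pow (e f : ℕ) (c : k) :
    (eval₂ (c ^ e • gen x₂) (c ^ f • gen y₂) : two k ⟶ two k) =
      desc fun z => c ^ pair e f z • gen z := by
  refine congrArg desc (funext fun z => ?_)
  rcases two_gens_cases z with rfl | rfl <;> simp [pair]

/-- A bijective twist has an invertible matrix: otherwise `a = ± b`, and then `x y` and `± y x` have
the same image. -/
theorem IsTwist.det_ne_zero {a b : k} {φ : RingAut k}
    {s : (two k).carrier → (two k).carrier} (hs : IsTwist a b φ s) (hinj : Function.Injective s) :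
    a * a - b * b ≠ 0 := by
  intro h0
  obtain ⟨ε, hε, hb⟩ : ∃ ε : k, ε * ε = 1 ∧ b = ε * a := by
    rcases mul_self_eq_mul_self_iff.1 (sub_eq_zero.1 h0) with h1 | h1
    · exact ⟨1, by ring, by rw [h1]; ring⟩
    · exact ⟨-1, by ring, by rw [h1]; ring⟩
  refine gen_mul_gen_ne_smul (φ.symm ε) (hinj ?_)
  rw [hs.smul, hs.mul, hs.mul, hs.of, hs.of, RingEquiv.apply_symm_apply, smul_add, smul_smul,
    smul_smul, ← hb, hb, ← mul_assoc, hε, one_mul, add_comm]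

namespace IsVerbal

variable {σ : ∀ X : FreeAlg k, Equiv.Perm X.carrier}

theorem map_eval₁ (h : IsVerbal σ) {Y : FreeAlg k} (u : Y.carrier) (p : (one k).carrier) :
    σ Y (app (eval₁ u) p) = app (eval₁ (σ Y u)) (σ (one k) p) :=
  h.map_desc _ _ _ _

theorem map_eval₂ (h : IsVerbal σ) {Y : FreeAlg k} (u v : Y.carrier) (p : (two k).carrier) :
    σ Y (app (eval₂ u v) p) = app (eval₂ (σ Y u) (σ Y v)) (σ (two k) p) := by
  rw [h.map_desc]
  congr 2
  funext z
  exact apply_ite _ _ _ _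

theorem map_zero (h : IsVerbal σ) (Y : FreeAlg k) : σ Y 0 = 0 := by
  -- The zero of `F(Y)` is the image of the only element of `F(∅)`.
  have := h.map_desc ⟨∅⟩ Y (fun _ => 0) 0
  rwa [eq_zero_of_gens_empty rfl (σ ⟨∅⟩ 0), app_zero, app_zero] at this

/-- The substitution `x ↦ c x` is invertible, hence so is `x ↦ σ (c x)`. -/
theorem exists_smul_gen (h : IsVerbal σ) (c : k) :
    ∃ d : k, σ (one k) (c • gen x₁) = d • gen x₁ := by
  by_cases hc : c = 0
  · exact ⟨0, by rw [hc, zero_smul, h.map_zero]⟩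
  · refine ⟨_, eq_smul_of_of_lift_const_eq_of x₁ (p := σ (one k) (c⁻¹ • gen x₁)) ?_⟩
    have := h.map_eval₁ (c • gen x₁) (c⁻¹ • gen x₁)
    rw [app_smul, eval₁_gen, inv_smul_smul₀ hc, h.map_gen] at this
    exact this.symm

theorem map_smul_of_map_smul_gen (h : IsVerbal σ) {c d : k}
    (hcd : σ (one k) (c • gen x₁) = d • gen x₁) {Y : FreeAlg k} (u : Y.carrier) :
    σ Y (c • u) = d • σ Y u := by
  have := h.map_eval₁ u (c • gen x₁)
  rwa [hcd, app_smul, app_smul, eval₁_gen, eval₁_gen] at this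

/-- The family `σ` is semilinear with respect to scalar multiplication. -/
theorem exists_semilinear (h : IsVerbal σ) :
    ∃ φ : k ≃ k, ∀ (Y : FreeAlg k) (c : k) (u : Y.carrier), σ Y (c • u) = φ c • σ Y u := by
  choose φ hφ using h.exists_smul_gen
  choose ψ hψ using h.symm.exists_smul_gen
  have hinj : ∀ c d : k, c • gen (X := one k) x₁ = d • gen x₁ → c = d := fun c d hcd =>
    smul_left_injective k (gen_ne_zero (X := one k) x₁) hcd
  refine ⟨⟨φ, ψ, fun c => hinj _ _ ?_, fun c => hinj _ _ ?_⟩,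
    fun Y c u => h.map_smul_of_map_smul_gen (hφ c) u⟩
  · rw [← hψ, ← hφ, Equiv.symm_apply_apply]
  · rw [← hφ, ← hψ, Equiv.apply_symm_apply]

/-- The polynomial `σ (x + y)` is homogeneous of degree one, because addition commutes with the
multiplication by scalars, of which there are infinitely many. -/
theorem map_add (h : IsVerbal σ) [Infinite k] {Y : FreeAlg k} (u v : Y.carrier) :
    σ Y (u + v) = σ Y u + σ Y v := by
  obtain ⟨φ, hφ⟩ := h.exists_semilinear
  set w := σ (two k) (gen x₂ + gen y₂) with hw
  have key : ∀ {Z : FreeAlg k} (u v : Z.carrier),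
      σ Z (u + v) = app (eval₂ (σ Z u) (σ Z v)) w := by
    intro Z u v
    rw [hw, ← h.map_eval₂, app_add, eval₂_x, eval₂_y]
  -- Every scalar is a value of `φ`, so `w` is compatible with rescaling by every scalar.
  have hscale : ∀ c : k, app (eval₂ (c ^ 1 • gen x₂) (c ^ 1 • gen y₂)) w = c • w := by
    intro c
    obtain ⟨d, rfl⟩ := φ.surjective c
    have := key (d • gen x₂) (d • gen y₂)
    rw [← smul_add, hφ, hφ, hφ, h.map_gen, h.map_gen] at this
    simpa only [pow_one] using this.symm
  have hone : (pair 1 1 : (two k).gens → ℕ) = 1 := funext fun z => ite_self _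
  obtain ⟨α, β, hαβ⟩ := eq_linear_of_weight (w := w) fun m hm => by
    refine weight_eq_one_of_rescale 1 w (fun c => ?_) hm
    rw [← hone]
    exact (congrArg (app · w) (eval₂_pair_pow 1 1 c)).symm.trans (hscale c)
  have hlin : ∀ {Z : FreeAlg k} (u v : Z.carrier), σ Z (u + v) = α • σ Z u + β • σ Z v := by
    intro Z u v
    rw [key, hαβ, app_add, app_smul, app_smul, eval₂_x, eval₂_y]
  have hα : α = 1 := by
    have := hlin (gen (X := one k) x₁) 0
    rw [add_zero, h.map_zero, h.map_gen, smul_zero, add_zero] at this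
    exact smul_left_injective k (gen_ne_zero (X := one k) x₁) (by simpa using this.symm)
  have hβ : β = 1 := by
    have := hlin 0 (gen (X := one k) x₁)
    rw [zero_add, h.map_zero, h.map_gen, smul_zero, zero_add] at this
    exact smul_left_injective k (gen_ne_zero (X := one k) x₁) (by simpa using this.symm)
  rw [hlin, hα, hβ, one_smul, one_smul]

/-- The polynomial `σ (x y)` is homogeneous of degree one in each variable. -/
theorem exists_map_mul (h : IsVerbal σ) [Infinite k] :
    ∃ a b : k, ∀ (Y : FreeAlg k) (u v : Y.carrier),
      σ Y (u * v) = a • (σ Y u * σ Y v) + b • (σ Y v * σ Y u) := by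
  obtain ⟨φ, hφ⟩ := h.exists_semilinear
  set w := σ (two k) (gen x₂ * gen y₂) with hw
  have key : ∀ {Z : FreeAlg k} (u v : Z.carrier),
      σ Z (u * v) = app (eval₂ (σ Z u) (σ Z v)) w := by
    intro Z u v
    rw [hw, ← h.map_eval₂, app_mul, eval₂_x, eval₂_y]
  have hx : ∀ c : k, app (eval₂ (c ^ 1 • gen x₂) (c ^ 0 • gen y₂)) w = c • w := by
    intro c
    obtain ⟨d, rfl⟩ := φ.surjective c
    have := key (d • gen x₂) (gen y₂)
    rw [smul_mul_assoc, hφ, hφ, h.map_gen, h.map_gen] at this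
    simpa only [pow_one, pow_zero, one_smul] using this.symm
  have hy : ∀ c : k, app (eval₂ (c ^ 0 • gen x₂) (c ^ 1 • gen y₂)) w = c • w := by
    intro c
    obtain ⟨d, rfl⟩ := φ.surjective c
    have := key (gen x₂) (d • gen y₂)
    rw [mul_smul_comm, hφ, hφ, h.map_gen, h.map_gen] at this
    simpa only [pow_one, pow_zero, one_smul] using this.symm
  obtain ⟨a, b, hab⟩ := eq_bilinear_of_weight (w := w)
    (fun m hm => weight_eq_one_of_rescale _ w (fun c =>
      (congrArg (app · w) (eval₂_pair_pow 1 0 c)).symm.trans (hx c)) hm)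
    (fun m hm => weight_eq_one_of_rescale _ w (fun c =>
      (congrArg (app · w) (eval₂_pair_pow 0 1 c)).symm.trans (hy c)) hm)
  refine ⟨a, b, fun Y u v => ?_⟩
  rw [key, hab, app_add, app_smul, app_smul, app_mul, app_mul, eval₂_x, eval₂_y]

theorem exists_isTwist (h : IsVerbal σ) [Infinite k] :
    ∃ (a b : k) (φ : RingAut k), ∀ Y : FreeAlg k, IsTwist a b φ (σ Y) := by
  obtain ⟨φ, hφ⟩ := h.exists_semilinear
  obtain ⟨a, b, hab⟩ := h.exists_map_mul
  have hinj : ∀ c d : k, c • gen (X := one k) x₁ = d • gen x₁ → c = d := fun c d hcd =>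
    smul_left_injective k (gen_ne_zero (X := one k) x₁) hcd
  have hval : ∀ c : k, σ (one k) (c • gen x₁) = φ c • gen x₁ := fun c => by rw [hφ, h.map_gen]
  refine ⟨a, b, { φ with map_mul' := fun c d => hinj _ _ ?_, map_add' := fun c d => hinj _ _ ?_ },
    fun Y => ⟨h.map_gen Y, h.map_add, hφ Y, hab Y⟩⟩
  · change φ (c * d) • _ = (φ c * φ d) • _
    rw [← hval, mul_smul, hφ, hval, mul_smul]
  · change φ (c + d) • _ = (φ c + φ d) • _
    rw [← hval, add_smul, h.map_add, hval, hval, add_smul]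

theorem exists_eq_twist (h : IsVerbal σ) [Infinite k] :
    ∃ p : Param k, ∀ Y : FreeAlg k, σ Y = twist Y.gens p := by
  obtain ⟨a, b, φ, hs⟩ := h.exists_isTwist
  have hdet := (hs (two k)).det_ne_zero (σ (two k)).injective
  let g : GL (Fin 2) k := Matrix.GeneralLinearGroup.mkOfDetNeZero !![a, b; b, a]
    (by rwa [Matrix.det_fin_two_of])
  refine ⟨⟨⟨g, a, b, rfl⟩, φ⟩, fun Y => Equiv.ext fun u => ?_⟩
  exact congrFun ((hs Y).unique (isTwist_twist (X := Y.gens) ⟨⟨g, a, b, rfl⟩, φ⟩)) u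

end IsVerbal

end Verbal

/-! ### Autoequivalences of the category are isomorphic to twists -/

section Autoequivalence

variable {k : Type u} [Field k]

open FreeAlg

theorem subsingleton_hom_of_gens_empty {X Y : FreeAlg k} (hX : X.gens = ∅) :
    Subsingleton (X ⟶ Y) :=
  ⟨fun _ _ => FreeAlg.hom_ext_gen fun x => absurd x.2 (Finset.eq_empty_iff_forall_notMem.1 hX x)⟩

theorem not_subsingleton_end_one : ¬ Subsingleton (one k ⟶ one k) := by
  intro h
  have := congrArg (app · (gen x₁)) (h.elim (𝟙 (one k)) (eval₁ 0))
  exact gen_ne_zero (X := one k) x₁ (this.trans (eval₁_gen 0))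

/-- Monomials of degree greater than one do not contribute to linear coefficients. -/
theorem linear_coeff_app {X : FreeAlg k} (r : one k ⟶ X) (u : (one k).carrier) (y : X.gens) :
    (app r u).coeff (FreeMagma.of y) =
      u.coeff (FreeMagma.of x₁) * (app r (gen x₁)).coeff (FreeMagma.of y) := by
  induction u using free_induction with
  | of x => obtain rfl := Subsingleton.elim x x₁; simp [coeff_of]
  | add u v hu hv => rw [app_add]; simp [hu, hv, add_mul]
  | smul c u hu => rw [app_smul]; simp [hu, mul_assoc]
  | mul u v _ _ => rw [app_mul, coeff_mul_of, coeff_mul_of, zero_mul]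
  | zero => rw [app_zero]; simp

/-- A retract of `F(x)` has at most one free generator, as is seen on linear coefficients. -/
theorem subsingleton_gens_of_retract {X : FreeAlg k} (i : X ⟶ one k) (r : one k ⟶ X)
    (hir : i ≫ r = 𝟙 X) : Subsingleton X.gens := by
  classical
  refine ⟨fun a b => ?_⟩
  by_contra hab
  have key : ∀ c d : X.gens, (app i (gen c)).coeff (FreeMagma.of x₁) *
      (app r (gen x₁)).coeff (FreeMagma.of d) = if c = d then 1 else 0 := by
    intro c d
    rw [← linear_coeff_app, ← app_comp, hir, app_id, coeff_of, Finsupp.single_apply]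
    simp only [of_inj_of]
  have haa := key a a
  have hbb := key b b
  have hba := key b a
  rw [if_pos rfl] at haa hbb
  rw [if_neg (Ne.symm hab)] at hba
  rcases mul_eq_zero.1 hba with h | h
  · rw [h, zero_mul] at hbb
    exact zero_ne_one hbb
  · rw [h, mul_zero] at haa
    exact zero_ne_one haa

theorem nonempty_iso_one {X : FreeAlg k} (x : X.gens) (hX : Subsingleton X.gens) :
    Nonempty (one k ≅ X) :=
  ⟨{  hom := eval₁ (gen x)
      inv := desc fun _ => gen x₁
      hom_inv_id := FreeAlg.hom_ext_gen fun y => by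
        obtain rfl := Subsingleton.elim y x₁
        rw [app_comp, eval₁_gen, app_desc_gen, app_id]
      inv_hom_id := FreeAlg.hom_ext_gen fun y => by
        obtain rfl := hX.elim x y
        rw [app_comp, app_desc_gen, eval₁_gen, app_id] }⟩

variable (F : FreeAlg k ⥤ FreeAlg k) [F.IsEquivalence]

/-- Up to isomorphism, `F(x)` is the smallest nonzero object with respect to retracts, so it is
preserved by every autoequivalence. -/
theorem nonempty_iso_obj_one : Nonempty (one k ≅ F.obj (one k)) := by
  have hX : (F.obj (one k)).gens.Nonempty := by
    rw [Finset.nonempty_iff_ne_empty]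
    intro h
    refine not_subsingleton_end_one (k := k) ⟨fun f g => F.map_injective ?_⟩
    exact (subsingleton_hom_of_gens_empty h).elim _ _
  let Z := F.objPreimage (one k)
  let j : F.obj Z ≅ one k := F.objObjPreimageIso (one k)
  have hZ : Z.gens.Nonempty := by
    rw [Finset.nonempty_iff_ne_empty]
    intro h
    refine not_subsingleton_end_one (k := k) ⟨fun f g => ?_⟩
    have := (subsingleton_hom_of_gens_empty h).elim
      (F.preimage (j.hom ≫ f ≫ j.inv)) (F.preimage (j.hom ≫ g ≫ j.inv))
    have := congrArg F.map this
    simpa using this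
  obtain ⟨z, hz⟩ := hZ
  obtain ⟨x, hx⟩ := hX
  have hret : eval₁ (gen (X := Z) ⟨z, hz⟩) ≫ (desc fun _ => gen x₁) = 𝟙 (one k) :=
    FreeAlg.hom_ext_gen fun y => by
      obtain rfl := Subsingleton.elim y x₁
      rw [app_comp, eval₁_gen, app_desc_gen, app_id]
  refine nonempty_iso_one ⟨x, hx⟩ (subsingleton_gens_of_retract
    (F.map (eval₁ (gen ⟨z, hz⟩)) ≫ j.hom) (j.inv ≫ F.map (desc fun _ => gen x₁)) ?_)
  rw [Category.assoc, Iso.hom_inv_id_assoc, ← F.map_comp, hret, F.map_id]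

/-- Elements of `F(X)` are morphisms from the free algebra in one variable. -/
def homOneEquiv (X : FreeAlg k) : (one k ⟶ X) ≃ X.carrier where
  toFun f := app f (gen x₁)
  invFun u := eval₁ u
  left_inv f := FreeAlg.hom_ext_gen fun y => by
    obtain rfl := Subsingleton.elim y x₁
    rw [eval₁_gen]
  right_inv u := eval₁_gen u

/-- The bijection of underlying sets induced by an isomorphism of free algebras. -/
def isoEquiv {X Y : FreeAlg k} (e : X ≅ Y) : X.carrier ≃ Y.carrier where
  toFun := app e.hom
  invFun := app e.inv
  left_inv u := by rw [← app_comp, e.hom_inv_id, app_id]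
  right_inv u := by rw [← app_comp, e.inv_hom_id, app_id]

variable {F}

/-- Representing elements by morphisms from `F(x)`, an autoequivalence acts on elements. -/
def elementEquiv (e : one k ≅ F.obj (one k)) (X : FreeAlg k) : X.carrier ≃ (F.obj X).carrier :=
  (homOneEquiv X).symm.trans <| (Functor.FullyFaithful.ofFullyFaithful F).homEquiv.trans <|
    (e.symm.homCongr (Iso.refl _)).trans (homOneEquiv (F.obj X))

theorem elementEquiv_app (e : one k ≅ F.obj (one k)) {X Y : FreeAlg k} (f : X ⟶ Y)
    (u : X.carrier) :
    elementEquiv e Y (app f u) = app (F.map f) (elementEquiv e X u) := by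
  have h : eval₁ (app f u) = eval₁ u ≫ f := FreeAlg.hom_ext_gen fun y => by
    obtain rfl := Subsingleton.elim y x₁
    rw [app_comp, eval₁_gen, eval₁_gen]
  change app (e.symm.inv ≫ F.map (eval₁ (app f u)) ≫ 𝟙 _) (gen x₁) =
    app (F.map f) (app (e.symm.inv ≫ F.map (eval₁ u) ≫ 𝟙 _) (gen x₁))
  rw [h, F.map_comp, Category.comp_id, Category.comp_id]
  rfl

/-- The images of the generators of `X` under `elementEquiv` freely generate `F.obj X`. -/
theorem exists_iso_obj (e : one k ≅ F.obj (one k)) (X : FreeAlg k) :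
    ∃ c : X ≅ F.obj X, ∀ x, app c.hom (gen x) = elementEquiv e X (gen x) := by
  let j : F.obj (F.objPreimage X) ≅ X := F.objObjPreimageIso X
  let s := elementEquiv e
  let c : X ⟶ F.obj X := desc fun x => s X (gen x)
  let d : F.obj X ⟶ X := F.map (desc fun x => (s _).symm (app j.inv (gen x))) ≫ j.hom
  have hc : ∀ x, app c (gen x) = s X (gen x) := fun x => app_desc_gen _ x
  have hd : ∀ x, app d (s X (gen x)) = gen x := fun x => by
    rw [app_comp, ← elementEquiv_app, app_desc_gen, Equiv.apply_symm_apply, ← app_comp,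
      j.inv_hom_id, app_id]
  refine ⟨⟨c, d, FreeAlg.hom_ext_gen fun x => by rw [app_comp, hc, hd, app_id], ?_⟩, hc⟩
  obtain ⟨f, hf⟩ := F.map_surjective (d ≫ c)
  rw [← hf]
  refine (congrArg F.map (FreeAlg.hom_ext_gen fun x => (s X).injective ?_)).trans (F.map_id X)
  rw [elementEquiv_app, hf, app_comp, hd, hc, app_id]

variable (F) in
/-- Transporting the action on elements along the isomorphisms `F.obj X ≅ X` gives permutations
compatible with substitutions, so they form a twist. -/
theorem exists_iso_twistFunctor [Infinite k] : ∃ p : Param k, Nonempty (F ≅ twistFunctor p) := by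
  obtain ⟨e⟩ := nonempty_iso_obj_one F
  choose c hc using exists_iso_obj (F := F) e
  let σ : ∀ X : FreeAlg k, Equiv.Perm X.carrier := fun X =>
    (elementEquiv e X).trans (isoEquiv (c X)).symm
  have hσ : ∀ {X Y : FreeAlg k} (f : X ⟶ Y) (u : X.carrier),
      σ Y (app f u) = app ((c X).hom ≫ F.map f ≫ (c Y).inv) (σ X u) := by
    intro X Y f u
    change app (c Y).inv (elementEquiv e Y (app f u)) =
      app ((c X).hom ≫ F.map f ≫ (c Y).inv) (app (c X).inv (elementEquiv e X u))
    rw [elementEquiv_app, ← app_comp, ← app_comp, Iso.inv_hom_id_assoc]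
  have hgen : ∀ (X : FreeAlg k) (x : X.gens), σ X (gen x) = gen x := by
    intro X x
    change app (c X).inv (elementEquiv e X (gen x)) = gen x
    rw [← hc, ← app_comp, Iso.hom_inv_id, app_id]
  have hverbal : IsVerbal σ := ⟨hgen, fun X Y g u => by
    rw [hσ]
    refine congrArg (app · _) (FreeAlg.hom_ext_gen fun x => ?_)
    have := hσ (desc g) (gen x)
    rw [hgen, app_desc_gen] at this
    rw [app_desc_gen, this]⟩
  obtain ⟨p, hp⟩ := hverbal.exists_eq_twist
  refine ⟨p, ⟨NatIso.ofComponents (fun X => (c X).symm) fun {X Y} f => ?_⟩⟩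
  change F.map f ≫ (c Y).inv = (c X).inv ≫ twistMap p f
  rw [Iso.eq_inv_comp]
  refine FreeAlg.hom_ext_gen fun x => ?_
  rw [app_twistMap_gen, ← hp, hσ, hgen]

end Autoequivalence

/-! ### The inner twists -/

section Inner

variable {k : Type u} [Field k]

open FreeAlg

theorem Param.det_ne_zero (p : Param k) : p.a * p.a - p.b * p.b ≠ 0 := by
  have := (p.left : GL (Fin 2) k).det_ne_zero
  rwa [p.coe_left, Matrix.det_fin_two_of] at this

/-- A natural isomorphism from a twist to the identity, composed with the twist, is a multiplication
by a scalar. -/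
theorem exists_app_twist_eq_smul {p : Param k} (η : twistFunctor p ≅ 𝟭 (FreeAlg k)) :
    ∃ (c : k) (α : ∀ X : FreeAlg k, X ⟶ X), c ≠ 0 ∧ ∀ (X : FreeAlg k) (u : X.carrier),
      app (α X) (twist X.gens p u) = c • u := by
  let α : ∀ X : FreeAlg k, X ⟶ X := fun X => η.hom.app X
  let β : ∀ X : FreeAlg k, X ⟶ X := fun X => η.inv.app X
  have hnat : ∀ {X Y : FreeAlg k} (f : X ⟶ Y), twistMap p f ≫ α Y = α X ≫ f :=
    fun f => η.hom.naturality f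
  have hβα : ∀ X, β X ≫ α X = 𝟙 X := fun X => η.inv_hom_id_app X
  have hα₁ : α (one k) = eval₁ (app (α (one k)) (gen x₁)) := by
    exact ((homOneEquiv (one k)).symm_apply_apply (α (one k))).symm
  have hq := eq_smul_of_of_lift_const_eq_of x₁ (q := app (α (one k)) (gen x₁))
    (p := app (β (one k)) (gen x₁)) (by
      change app (eval₁ _) _ = gen x₁
      rw [← hα₁, ← app_comp, hβα, app_id])
  set c := (app (α (one k)) (gen x₁)).coeff (FreeMagma.of x₁)
  have key : ∀ (X : FreeAlg k) (u : X.carrier), app (α X) (twist X.gens p u) = c • u := by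
    intro X u
    have := congrArg (app · (gen x₁)) (hnat (eval₁ u))
    simp only [app_comp, app_twistMap_gen] at this
    rw [hq] at this
    rwa [app_smul, eval₁_gen] at this
  refine ⟨c, α, ?_, key⟩
  intro hc
  have h1 := congrArg (app (β (one k))) (key (one k) (gen x₁))
  rw [hc, zero_smul, app_zero, ← app_comp] at h1
  have h2 : α (one k) ≫ β (one k) = 𝟙 _ := η.hom_inv_id_app (one k)
  rw [h2, app_id, (isTwist_twist p).of] at h1
  exact gen_ne_zero _ h1

theorem right_eq_one_and_b_eq_zero {p : Param k} (η : twistFunctor p ≅ 𝟭 (FreeAlg k)) :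
    p.right = 1 ∧ p.b = 0 := by
  obtain ⟨c, α, hc, h⟩ := exists_app_twist_eq_smul η
  constructor
  · refine RingEquiv.ext fun d => ?_
    have := h (one k) (d • gen x₁)
    rw [(isTwist_twist p).smul, app_smul, h, smul_comm] at this
    exact smul_left_injective k (gen_ne_zero (X := one k) x₁)
      (smul_right_injective _ hc this)
  · have hx := h (two k) (gen x₂)
    have hy := h (two k) (gen y₂)
    have hxy := h (two k) (gen x₂ * gen y₂)
    rw [(isTwist_twist p).mul, app_add, app_smul, app_smul, app_mul, app_mul, hx, hy] at hxy
    have := congrArg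
      (fun v : (two k).carrier => v.coeff (FreeMagma.of y₂ * FreeMagma.of x₂)) hxy
    simpa [coeff_mul_mul, coeff_of, of_inj_of, hc, x₂_ne_y₂] using this

/-- A twist with parameters `φ = 1` and `b = 0` becomes a homomorphism when it is multiplied by
`a`. -/
theorem app_desc_smul_gen {p : Param k} (hφ : p.right = 1) (hb : p.b = 0) {X : FreeAlg k}
    (u : X.carrier) :
    app (desc fun x : X.gens => p.a • gen x) u = p.a • twist X.gens p u := by
  have hs := isTwist_twist (X := X.gens) p
  induction u using free_induction with
  | of x => rw [hs.of]; exact app_desc_gen _ x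
  | add u v hu hv => rw [app_add, hs.add, hu, hv, smul_add]
  | smul c u hu => rw [app_smul, hs.smul, hu, hφ, smul_comm]; rfl
  | mul u v hu hv => rw [app_mul, hs.mul, hu, hv, hb, zero_smul, add_zero, smul_mul_smul_comm,
      smul_smul]
  | zero => rw [app_zero, hs.zero, smul_zero]

theorem nonempty_twistFunctor_iso_id {p : Param k} (hφ : p.right = 1) (hb : p.b = 0) :
    Nonempty (twistFunctor p ≅ 𝟭 (FreeAlg k)) := by
  have ha : p.a ≠ 0 := fun ha => p.det_ne_zero (by rw [ha, hb]; ring)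
  let D : ∀ X : FreeAlg k, X ≅ X := fun X =>
    { hom := desc fun x : X.gens => p.a • gen x
      inv := desc fun x : X.gens => p.a⁻¹ • gen x
      hom_inv_id := FreeAlg.hom_ext_gen fun x => by
        rw [app_comp, app_desc_gen, app_smul, app_desc_gen, smul_inv_smul₀ ha, app_id]
      inv_hom_id := FreeAlg.hom_ext_gen fun x => by
        rw [app_comp, app_desc_gen, app_smul, app_desc_gen, inv_smul_smul₀ ha, app_id] }
  refine ⟨NatIso.ofComponents (fun X => (D X).symm) fun {X Y} f => ?_⟩
  change twistMap p f ≫ (D Y).inv = (D X).inv ≫ f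
  rw [Iso.eq_inv_comp, ← Category.assoc, Iso.comp_inv_eq]
  refine FreeAlg.hom_ext_gen fun x => ?_
  rw [app_comp, app_comp]
  change app (twistMap p f) (app (desc fun x : X.gens => p.a • gen x) (gen x)) =
    app (desc fun x : Y.gens => p.a • gen x) (app f (gen x))
  rw [app_desc_gen, app_smul, app_twistMap_gen, app_desc_smul_gen hφ hb]

end Inner

/-! ### The group of automorphisms modulo the inner ones -/

section Quotient

variable {k : Type u} [Field k]

theorem mk_eq_mk_of_iso {C : Type*} [Category C] {Φ Ψ : CatAut C}
    (e : Φ.hom.toFunctor ≅ Ψ.hom.toFunctor) :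
    (Φ : CatAut C ⧸ innerAut C) = Ψ := by
  refine (QuotientGroup.eq.2 ?_).symm
  have h : Ψ.hom.toFunctor ⋙ Ψ.inv.toFunctor = 𝟭 C := congrArg Cat.Hom.toFunctor Ψ.hom_inv_id
  exact ⟨Functor.isoWhiskerRight e Ψ.inv.toFunctor ≪≫ eqToIso h⟩

theorem isEquivalence_of_catAut {C : Type*} [Category C] (Φ : CatAut C) :
    (show C ⥤ C from Φ.hom.toFunctor).IsEquivalence := by
  have h : Φ.hom.toFunctor ⋙ Φ.inv.toFunctor = 𝟭 C := congrArg Cat.Hom.toFunctor Φ.hom_inv_id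
  have h' : Φ.inv.toFunctor ⋙ Φ.hom.toFunctor = 𝟭 C := congrArg Cat.Hom.toFunctor Φ.inv_hom_id
  exact Functor.IsEquivalence.mk' Φ.inv.toFunctor (eqToIso h.symm) (eqToIso h')

variable (k) in
/-- The homomorphism from the group of parameters to the automorphisms modulo the inner ones. -/
def twistClass : Param k →* CatAut (FreeAlg k) ⧸ innerAut (FreeAlg k) :=
  (QuotientGroup.mk' _).comp (twistAut k)

theorem twistClass_surjective [Infinite k] : Function.Surjective (twistClass k) := by
  intro y
  obtain ⟨Φ, rfl⟩ := QuotientGroup.mk_surjective y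
  have := isEquivalence_of_catAut Φ
  obtain ⟨p, ⟨e⟩⟩ := exists_iso_twistFunctor (show FreeAlg k ⥤ FreeAlg k from Φ.hom.toFunctor)
  exact ⟨p, (mk_eq_mk_of_iso (Ψ := twistAut k p) e).symm⟩

theorem mem_ker_twistClass (p : Param k) : p ∈ (twistClass k).ker ↔ p.right = 1 ∧ p.b = 0 := by
  rw [MonoidHom.mem_ker]
  change QuotientGroup.mk' _ (twistAut k p) = 1 ↔ _
  rw [QuotientGroup.mk'_apply, QuotientGroup.eq_one_iff]
  change Nonempty (twistFunctor p ≅ 𝟭 (FreeAlg k)) ↔ _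
  exact ⟨fun ⟨η⟩ => right_eq_one_and_b_eq_zero η, fun h => nonempty_twistFunctor_iso_id h.1 h.2⟩

theorem mem_scalarMat (g : matG k) : g ∈ scalarMat k ↔ (g : GL (Fin 2) k).1 0 1 = 0 := by
  have hg := matG_coe g
  constructor
  · rintro ⟨c, hc⟩
    change Matrix.GeneralLinearGroup.scalar (Fin 2) c = (g : GL (Fin 2) k) at hc
    rw [← hc]
    simp
  · intro h0
    have hdet := (g : GL (Fin 2) k).det_ne_zero
    rw [hg, Matrix.det_fin_two_of, h0, mul_zero, sub_zero] at hdet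
    refine ⟨Units.mk0 _ (left_ne_zero_of_mul hdet), Units.ext ?_⟩
    rw [h0] at hg
    refine Eq.trans ?_ hg.symm
    ext i j
    fin_cases i <;> fin_cases j <;> simp

variable (k) in
/-- The projection of the group of parameters onto `(G / k* I₂) ⋊ Aut k`. -/
def paramQuotient : Param k →* (matG k ⧸ scalarMat k) ⋊[autActMatQuotient k] RingAut k :=
  SemidirectProduct.map (QuotientGroup.mk' _) (MonoidHom.id _) fun _ => rfl

theorem paramQuotient_surjective : Function.Surjective (paramQuotient k) := by
  rintro ⟨n, φ⟩
  obtain ⟨g, rfl⟩ := QuotientGroup.mk_surjective n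
  exact ⟨⟨g, φ⟩, rfl⟩

theorem mem_ker_paramQuotient (p : Param k) :
    p ∈ (paramQuotient k).ker ↔ p.right = 1 ∧ p.b = 0 := by
  rw [MonoidHom.mem_ker, SemidirectProduct.ext_iff, and_comm]
  refine and_congr Iff.rfl ?_
  change (p.left : matG k ⧸ scalarMat k) = 1 ↔ _
  rw [QuotientGroup.eq_one_iff, mem_scalarMat]
  rfl

variable (k) in
/-- The automorphisms of `Θ⁰` modulo the inner ones form the group `(G / k* I₂) ⋊ Aut k`. -/
def catAutQuotientEquiv [Infinite k] :
    (CatAut (FreeAlg k) ⧸ innerAut (FreeAlg k)) ≃*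
      ((matG k ⧸ scalarMat k) ⋊[autActMatQuotient k] RingAut k) :=
  (QuotientGroup.quotientKerEquivOfSurjective _ twistClass_surjective).symm.trans <|
    (QuotientGroup.quotientMulEquivOfEq (Subgroup.ext fun p => by
      rw [mem_ker_twistClass, mem_ker_paramQuotient])).trans <|
    QuotientGroup.quotientKerEquivOfSurjective _ paramQuotient_surjective

end Quotient

/-! ### Matrices and the group algebra of the symmetric group -/

section GroupAlgebra

variable {k : Type u} [Field k]

/-- The element `a e + b (12)` of `k S₂`. -/
def kS₂.mk (a b : k) : kS₂ k :=
  MonoidAlgebra.single 1 a + MonoidAlgebra.single (Equiv.swap 0 1) b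

theorem kS₂.mk_mul (a b c d : k) :
    mk a b * mk c d = mk (a * c + b * d) (a * d + b * c) := by
  simp only [mk, add_mul, mul_add, MonoidAlgebra.single_mul_single, one_mul, mul_one,
    Equiv.swap_mul_self, MonoidAlgebra.single_add]
  abel

theorem kS₂.one_eq_mk : (1 : kS₂ k) = mk 1 0 := by
  simp [mk, MonoidAlgebra.one_def]

theorem kS₂.mk_inj {a b c d : k} : mk a b = mk c d ↔ a = c ∧ b = d := by
  constructor
  · intro h
    have h1 := congrArg (fun v : kS₂ k => v.coeff 1) h
    have h2 := congrArg (fun v : kS₂ k => v.coeff (Equiv.swap 0 1)) h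
    have hs : (Equiv.swap 0 1 : Equiv.Perm (Fin 2)) ≠ 1 := by decide
    simp [mk, hs, hs.symm] at h1 h2
    exact ⟨h1, h2⟩
  · rintro ⟨rfl, rfl⟩
    rfl

theorem kS₂.exists_eq_mk (u : kS₂ k) : ∃ a b : k, u = mk a b := by
  have hperm : ∀ g : Equiv.Perm (Fin 2), g = 1 ∨ g = Equiv.swap 0 1 := by decide
  induction u using MonoidAlgebra.induction_linear with
  | zero => exact ⟨0, 0, by simp [mk]⟩
  | add u v hu hv =>
    obtain ⟨a, b, rfl⟩ := hu
    obtain ⟨c, d, rfl⟩ := hv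
    refine ⟨a + c, b + d, ?_⟩
    simp only [mk, MonoidAlgebra.single_add]
    abel
  | single g c =>
    rcases hperm g with rfl | rfl
    · exact ⟨c, 0, by simp [mk]⟩
    · exact ⟨0, c, by simp [mk]⟩

theorem kS₂.mapRingEquiv_mk (φ : RingAut k) (a b : k) :
    MonoidAlgebra.mapRingEquiv (Equiv.Perm (Fin 2)) φ (mk a b) = mk (φ a) (φ b) := by
  simp [mk]

theorem matG_mul_apply (g h : matG k) :
    ((g * h : matG k) : GL (Fin 2) k).1 0 0 =
        (g : GL (Fin 2) k).1 0 0 * (h : GL (Fin 2) k).1 0 0 +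
          (g : GL (Fin 2) k).1 0 1 * (h : GL (Fin 2) k).1 0 1 ∧
      ((g * h : matG k) : GL (Fin 2) k).1 0 1 =
        (g : GL (Fin 2) k).1 0 0 * (h : GL (Fin 2) k).1 0 1 +
          (g : GL (Fin 2) k).1 0 1 * (h : GL (Fin 2) k).1 0 0 := by
  have hgh : ((g * h : matG k) : GL (Fin 2) k).1 = (g : GL (Fin 2) k).1 * (h : GL (Fin 2) k).1 :=
    rfl
  rw [hgh, matG_coe g, matG_coe h, Matrix.mul_fin_two]
  simp

variable (k) in
/-- The matrix `(a b; b a)` as the unit `a e + b (12)` of `k S₂`. -/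
def matGToUnits : matG k →* (kS₂ k)ˣ :=
  MonoidHom.toHomUnits
    { toFun := fun g => kS₂.mk ((g : GL (Fin 2) k).1 0 0) ((g : GL (Fin 2) k).1 0 1)
      map_one' := by simp [kS₂.one_eq_mk]
      map_mul' := fun g h => by
        rw [kS₂.mk_mul, (matG_mul_apply g h).1, (matG_mul_apply g h).2] }

theorem coe_matGToUnits (g : matG k) : (matGToUnits k g : kS₂ k) =
    kS₂.mk ((g : GL (Fin 2) k).1 0 0) ((g : GL (Fin 2) k).1 0 1) := rfl

theorem matGToUnits_injective : Function.Injective (matGToUnits k) := by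
  intro g h hgh
  have := congrArg Units.val hgh
  rw [coe_matGToUnits, coe_matGToUnits, kS₂.mk_inj] at this
  refine Subtype.ext (Units.ext ?_)
  rw [matG_coe g, matG_coe h, this.1, this.2]

theorem matGToUnits_surjective : Function.Surjective (matGToUnits k) := by
  intro u
  obtain ⟨a, b, hab⟩ := kS₂.exists_eq_mk (u : kS₂ k)
  obtain ⟨c, d, hcd⟩ := kS₂.exists_eq_mk ((u⁻¹ : (kS₂ k)ˣ) : kS₂ k)
  have h := u.mul_inv
  rw [hab, hcd, kS₂.mk_mul, kS₂.one_eq_mk, kS₂.mk_inj] at h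
  -- The norm `a² - b²` is multiplicative.
  have hnorm : (a * a - b * b) * (c * c - d * d) = 1 := by
    calc (a * a - b * b) * (c * c - d * d)
        = (a * c + b * d) ^ 2 - (a * d + b * c) ^ 2 := by ring
      _ = 1 := by rw [h.1, h.2]; ring
  exact ⟨⟨Matrix.GeneralLinearGroup.mkOfDetNeZero !![a, b; b, a]
    (by rw [Matrix.det_fin_two_of]; exact left_ne_zero_of_mul_eq_one hnorm), a, b, rfl⟩,
    Units.ext hab.symm⟩

variable (k) in
/-- The group `G` is the group of units of `k S₂`. -/
def matGEquiv : matG k ≃* (kS₂ k)ˣ :=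
  MulEquiv.ofBijective (matGToUnits k) ⟨matGToUnits_injective, matGToUnits_surjective⟩

theorem coe_matGEquiv (g : matG k) : (matGEquiv k g : kS₂ k) =
    kS₂.mk ((g : GL (Fin 2) k).1 0 0) ((g : GL (Fin 2) k).1 0 1) := rfl

theorem matGEquiv_mem_unitsKE (g : matG k) : matGEquiv k g ∈ unitsKE k ↔ g ∈ scalarMat k := by
  have halg : ∀ c : k, algebraMap k (kS₂ k) c = kS₂.mk c 0 := fun c => by simp [kS₂.mk]
  rw [mem_unitsKE, mem_scalarMat, coe_matGEquiv]
  constructor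
  · rintro ⟨c, hc⟩
    rw [halg, kS₂.mk_inj] at hc
    exact hc.2
  · intro h0
    have hdet := (g : GL (Fin 2) k).det_ne_zero
    rw [matG_coe g, Matrix.det_fin_two_of, h0, mul_zero, sub_zero] at hdet
    exact ⟨Units.mk0 _ (left_ne_zero_of_mul hdet), by rw [halg, h0]; rfl⟩

theorem matGEquiv_autActG (φ : RingAut k) (g : matG k) :
    matGEquiv k (autActG k φ g) = autActKS₂ k φ (matGEquiv k g) :=
  Units.ext (kS₂.mapRingEquiv_mk φ _ _).symm

variable (k) in
/-- The isomorphism `G / k* I₂ ≅ U(k S₂) / U(k{e})`. -/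
def matGQuotientEquiv : (matG k ⧸ scalarMat k) ≃* ((kS₂ k)ˣ ⧸ unitsKE k) :=
  QuotientGroup.congr _ _ (matGEquiv k) (by
    ext u
    obtain ⟨g, rfl⟩ := (matGEquiv k).surjective u
    rw [matGEquiv_mem_unitsKE]
    exact Subgroup.mem_map_equiv.trans (by simp))

variable (k) in
/-- The isomorphism of semidirect products induced by `G / k* I₂ ≅ U(k S₂) / U(k{e})`. -/
def semidirectEquiv : ((matG k ⧸ scalarMat k) ⋊[autActMatQuotient k] RingAut k) ≃*
    (((kS₂ k)ˣ ⧸ unitsKE k) ⋊[autActUnitsQuotient k] RingAut k) :=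
  SemidirectProduct.congr (matGQuotientEquiv k) (MulEquiv.refl _) fun φ => by
    ext x
    induction x using QuotientGroup.induction_on with
    | H g => exact congrArg QuotientGroup.mk (matGEquiv_autActG φ g)

end GroupAlgebra

/-! ### Infinitely many classes -/

section Infinite

variable (k : Type u) [Field k]

/-- The matrices `(1 c; c 1)` with `c² ≠ 1` are pairwise not proportional. -/
instance infinite_matG_quotient [Infinite k] : Infinite (matG k ⧸ scalarMat k) := by
  have hfin : {c : k | c * c = 1}.Finite :=
    (Set.toFinite {1, -1}).subset fun c hc => mul_self_eq_one_iff.1 hc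
  have hinf : Infinite ↥({c : k | c * c = 1}ᶜ) := hfin.infinite_compl.to_subtype
  let g : ↥({c : k | c * c = 1}ᶜ) → matG k := fun c =>
    ⟨Matrix.GeneralLinearGroup.mkOfDetNeZero !![1, c.1; c.1, 1]
      (by
        rw [Matrix.det_fin_two_of, one_mul]
        exact sub_ne_zero.2 (Ne.symm c.2)), 1, c.1, rfl⟩
  refine Infinite.of_injective (fun c => (g c : matG k ⧸ scalarMat k)) fun c d hcd => ?_
  obtain ⟨s, hs, hcs⟩ : ∃ s ∈ scalarMat k, g c * s = g d := ⟨_, QuotientGroup.eq.1 hcd, by simp⟩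
  rw [mem_scalarMat] at hs
  have h0 := (matG_mul_apply (g c) s).1
  have h1 := (matG_mul_apply (g c) s).2
  rw [hcs, hs, mul_zero, add_zero] at h0
  rw [hcs, hs, mul_zero, zero_add] at h1
  change (1 : k) = 1 * _ at h0
  change d.1 = c.1 * _ at h1
  rw [one_mul] at h0
  rw [← h0, mul_one] at h1
  exact Subtype.ext h1.symm

end Infinite

end LinearAlgebras

end

theorem mainTheorem4 (k : Type*) [Field k] [Infinite k] :
    Nonempty
      ((LinearAlgebras.CatAut (LinearAlgebras.FreeAlg k) ⧸
          LinearAlgebras.innerAut (LinearAlgebras.FreeAlg k)) ≃*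
        ((LinearAlgebras.matG k ⧸ LinearAlgebras.scalarMat k)
          ⋊[LinearAlgebras.autActMatQuotient k] RingAut k)) ∧
    Nonempty
      ((LinearAlgebras.CatAut (LinearAlgebras.FreeAlg k) ⧸
          LinearAlgebras.innerAut (LinearAlgebras.FreeAlg k)) ≃*
        (((LinearAlgebras.kS₂ k)ˣ ⧸ LinearAlgebras.unitsKE k)
          ⋊[LinearAlgebras.autActUnitsQuotient k] RingAut k)) ∧
    Infinite
      (LinearAlgebras.CatAut (LinearAlgebras.FreeAlg k) ⧸
        LinearAlgebras.innerAut (LinearAlgebras.FreeAlg k)) := by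
  refine ⟨⟨LinearAlgebras.catAutQuotientEquiv k⟩,
    ⟨(LinearAlgebras.catAutQuotientEquiv k).trans (LinearAlgebras.semidirectEquiv k)⟩, ?_⟩
  have : Infinite ((LinearAlgebras.matG k ⧸ LinearAlgebras.scalarMat k)
      ⋊[LinearAlgebras.autActMatQuotient k] RingAut k) :=
    Infinite.of_injective _ SemidirectProduct.inl_injective
  exact Infinite.of_injective _ (LinearAlgebras.catAutQuotientEquiv k).symm.injective
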